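/- For a bounded domain $D\subset\mathbb{C}$ and $p\in D$, let the squeezing function of $D$ at $p$ be $$s_D(p)=\sup_f\ \sup\{t : \{|w|<t\}\subset f(D)\},$$ where $f$ runs over all injective holomorphic maps from $D$ into the open unit disc with $f(p)=0$. Let $0<r<1$ and $A_r=\{z\in\mathbb{C} : r<|z|<1\}$. Then $s_{A_r}(z)=s_{A_r}(|z|)$ for all $z\in A_r$, and $s_{A_r}(r/\rho)=s_{A_r}(\rho)$ for all $\rho\in(r,1)$, so $s_{A_r}$ may be viewed as a function of $\rho=|z|\in[\sqrt r,1)$. Viewed in this way, $\rho\mapsto s_{A_r}(\rho)$ is strictly increasing on $[\sqrt r,1)$. In particular, $s_{A_r}$ attains its minimum over $A_r$ at every point of the circle $|z|=\sqrt r$. -/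

import Mathlib

/-- `f` is a holomorphic embedding of the domain `D` (in the complex Euclidean space `E`) into the
open unit ball of `E`, sending `p` to the origin. As `D` is an open subset of a space of the same
finite dimension, an injective holomorphic map is automatically an open embedding. -/
structure IsHolomorphicEmbeddingIntoBall {E : Type*} [NormedAddCommGroup E]
    [InnerProductSpace ℂ E] [FiniteDimensional ℂ E] (D : Set E) (p : E) (f : E → E) : Prop where
  differentiableOn : DifferentiableOn ℂ f D
  injOn : Set.InjOn f D
  mapsTo : Set.MapsTo f D (Metric.ball 0 1)
  map_base : f p = 0

/-- `s_D(p, f)`: the supremum of the `r` such that the ball of radius `r` about the origin lies in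
the image `f(D)`. -/
noncomputable def squeezingRadius {E : Type*} [NormedAddCommGroup E]
    [InnerProductSpace ℂ E] [FiniteDimensional ℂ E] [Nontrivial E]
    (D : Set E) (f : E → E) : ℝ :=
  sSup {r : ℝ | Metric.ball (0 : E) r ⊆ f '' D}

/-- The squeezing function `s_D` of a bounded domain `D`, at the point `p ∈ D`: the supremum of
`s_D(p, f)` over all holomorphic embeddings `f` of `D` into the unit ball with `f p = 0`. -/
noncomputable def squeezingFunction {E : Type*} [NormedAddCommGroup E]
    [InnerProductSpace ℂ E] [FiniteDimensional ℂ E] [Nontrivial E]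
    (D : Set E) (p : E) : ℝ :=
  sSup {s : ℝ | ∃ f : E → E, IsHolomorphicEmbeddingIntoBall D p f ∧ s = squeezingRadius D f}

/-- The annulus `A_r = {z ∈ ℂ : r < |z| < 1}`. -/
def annulus (r : ℝ) : Set ℂ := {z | r < ‖z‖ ∧ ‖z‖ < 1}

open Complex Set Filter Topology Metric Real ComplexConjugate

/-! The point is that s(ρ) = ρ for √r ≤ ρ < 1. Rotations and z ↦ r/z are automorphisms of the
annulus and give the two symmetries; monotonicity and the minimum are then read off.

Upper bound (`squeezingRadius_annulus_le`): an embedding f with f(ρ) = 0 has a single simple zero,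
so f = (z - ρ)g with g zero-free. The mean of log ‖g‖ over ‖z‖ = s is k log s + c with k an integer,
hence that of log ‖f‖ is log max(s, ρ) + k log s + c. If f(A) contains the disc of radius t, then
for every t' < t one has t' < ‖f‖ < 1 near both boundary circles, so the limits of the mean, c at s
= 1 and log ρ + k log r + c at s = r, lie in [log t', 0]. For k ≥ 0 this gives t' ≤ ρ, and for k ≤
-1 it gives t' ≤ r/ρ. When ρ ≥ √r the larger bound is ρ.

Lower bound: `slitMap` is z - ρ times a quotient of q-products with q = r², arranged so that its
modulus is 1 on the outer circle and ρ on the inner one. The argument principle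
(`slitMap_zeroCount`) counts one preimage of w if ‖w‖ < 1 and ‖w‖ ≠ ρ, and none if ‖w‖ > 1. So the
map is an embedding into the unit disc whose image contains the disc of radius ρ. -/

/-! ### Holomorphic logarithms and circle means on the annulus -/

theorem exists_differentiableOn_exp_eq {U : Set ℂ} (hU : IsOpen U) (hc : Convex ℝ U)
    (hne : U.Nonempty) {G : ℂ → ℂ} (hG : DifferentiableOn ℂ G U) (h0 : ∀ z ∈ U, G z ≠ 0) :
    ∃ Φ : ℂ → ℂ, DifferentiableOn ℂ Φ U ∧ ∀ z ∈ U, cexp (Φ z) = G z := by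
  have hs : IsSimplyConnected U := by
    have := hc.contractibleSpace hne
    show SimplyConnectedSpace U
    infer_instance
  obtain ⟨Φ, hΦc, hΦ⟩ := exists_continuousOn_eqOn_exp_comp hs hU hG.continuousOn
    (by rintro ⟨z, hz, h⟩; exact h0 z hz h)
  refine ⟨Φ, fun z₀ hz₀ ↦ DifferentiableAt.differentiableWithinAt ?_, fun z hz ↦ hΦ hz⟩
  have hcont : ContinuousAt Φ z₀ := hΦc.continuousAt (hU.mem_nhds hz₀)
  -- A continuous logarithm agrees locally with a branch of `log`: the imaginary parts differ by
  -- less than π near z₀.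
  have hev : ∀ᶠ z in 𝓝 z₀, Φ z = Φ z₀ + Complex.log (G z / G z₀) := by
    have h1 : ∀ᶠ z in 𝓝 z₀, ‖Φ z - Φ z₀‖ < π := by
      have : Tendsto (fun z ↦ ‖Φ z - Φ z₀‖) (𝓝 z₀) (𝓝 ‖Φ z₀ - Φ z₀‖) :=
        (hcont.sub continuousAt_const).norm
      rw [sub_self, norm_zero] at this
      exact this.eventually_lt_const pi_pos
    filter_upwards [h1, hU.mem_nhds hz₀] with z hz hzU
    have e1 : cexp (Φ z) = G z := hΦ hzU
    have e2 : cexp (Φ z₀) = G z₀ := hΦ hz₀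
    have him := abs_lt.1 ((abs_im_le_norm _).trans_lt hz)
    rw [← e1, ← e2, ← Complex.exp_sub, Complex.log_exp him.1 him.2.le]
    ring
  refine DifferentiableAt.congr_of_eventuallyEq ?_ hev
  refine (differentiableAt_const _).add (DifferentiableAt.clog ?_ ?_)
  · exact (hG.differentiableAt (hU.mem_nhds hz₀)).div_const _
  · rw [div_self (h0 _ hz₀)]; exact one_mem_slitPlane

theorem isOpen_annulus (r : ℝ) : IsOpen (annulus r) :=
  (isOpen_lt continuous_const continuous_norm).inter (isOpen_lt continuous_norm continuous_const)

theorem isOpen_reStrip (a b : ℝ) : IsOpen {z : ℂ | a < z.re ∧ z.re < b} :=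
  (isOpen_lt continuous_const continuous_re).inter (isOpen_lt continuous_re continuous_const)

theorem convex_reStrip (a b : ℝ) : Convex ℝ {z : ℂ | a < z.re ∧ z.re < b} :=
  (convex_halfSpace_re_gt a).inter (convex_halfSpace_re_lt b)

theorem exp_mem_annulus {r : ℝ} (hr0 : 0 < r) {z : ℂ} (h : Real.log r < z.re ∧ z.re < 0) :
    cexp z ∈ annulus r := by
  simp only [annulus, mem_ofPred_eq, Complex.norm_exp]
  exact ⟨(Real.log_lt_iff_lt_exp hr0).1 h.1, Real.exp_lt_one_iff.2 h.2⟩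

theorem isPreconnected_annulus {r : ℝ} (hr0 : 0 < r) : IsPreconnected (annulus r) := by
  have : annulus r = cexp '' {z : ℂ | Real.log r < z.re ∧ z.re < 0} := by
    ext z
    constructor
    · rintro ⟨h1, h2⟩
      have hz : 0 < ‖z‖ := hr0.trans h1
      refine ⟨Complex.log z, ?_, Complex.exp_log (norm_pos_iff.1 hz)⟩
      simp only [mem_ofPred_eq, Complex.log_re]
      exact ⟨Real.log_lt_log hr0 h1, Real.log_neg hz h2⟩
    · rintro ⟨w, hw, rfl⟩
      exact exp_mem_annulus hr0 hw
  rw [this]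
  exact (convex_reStrip _ _).isPreconnected.image _ continuous_exp.continuousOn

/-- The mean of `log ‖g‖` over concentric circles is affine in the logarithm of the radius, with
integral slope, when `g` has no zeros. -/
theorem exists_circleAverage_log_norm_eq {r : ℝ} (hr0 : 0 < r) (hr1 : r < 1) {g : ℂ → ℂ}
    (hg : DifferentiableOn ℂ g (annulus r)) (h0 : ∀ z ∈ annulus r, g z ≠ 0) :
    ∃ (k : ℤ) (c : ℝ), ∀ s ∈ Ioo r 1,
      circleAverage (fun z ↦ Real.log ‖g z‖) 0 s = k * Real.log s + c := by
  set S : Set ℂ := {z : ℂ | Real.log r < z.re ∧ z.re < 0} with hS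
  have hSo : IsOpen S := isOpen_reStrip _ _
  have hlog : Real.log r < 0 := Real.log_neg hr0 hr1
  have hSne : S.Nonempty := ⟨((Real.log r / 2 : ℝ) : ℂ), by
    simp only [hS, mem_ofPred_eq, ofReal_re]; constructor <;> linarith⟩
  have hmaps : MapsTo cexp S (annulus r) := fun z hz ↦ exp_mem_annulus hr0 hz
  obtain ⟨Φ, hΦd, hΦ⟩ := exists_differentiableOn_exp_eq hSo (convex_reStrip _ _) hSne
    (G := fun z ↦ g (cexp z)) (hg.comp differentiable_exp.differentiableOn hmaps)
    (fun z hz ↦ h0 _ (hmaps hz))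
  have hshift : MapsTo (fun z : ℂ ↦ z + 2 * π * I) S S := by
    intro z hz
    simpa [hS] using hz
  have hD : ∃ a : ℂ, ∀ z ∈ S, Φ (z + 2 * π * I) - Φ z = a := by
    have hd : DifferentiableOn ℂ (fun z ↦ Φ (z + 2 * π * I) - Φ z) S :=
      (hΦd.comp (by fun_prop) hshift).sub hΦd
    refine hSo.exists_is_const_of_deriv_eq_zero (convex_reStrip _ _).isPreconnected hd ?_
    intro z hz
    have h1 := (hd.differentiableAt (hSo.mem_nhds hz)).hasDerivAt.cexp
    have h2 : (fun z ↦ cexp (Φ (z + 2 * π * I) - Φ z)) =ᶠ[𝓝 z] fun _ ↦ 1 := by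
      filter_upwards [hSo.mem_nhds hz] with w hw
      rw [Complex.exp_sub, hΦ _ hw, hΦ _ (hshift hw), Complex.exp_periodic w, div_self]
      exact h0 _ (hmaps hw)
    have h3 := h1.unique ((hasDerivAt_const z (1 : ℂ)).congr_of_eventuallyEq h2)
    simpa using h3
  obtain ⟨a, ha⟩ := hD
  obtain ⟨k, rfl⟩ : ∃ k : ℤ, a = k * (2 * π * I) := by
    obtain ⟨z, hz⟩ := hSne
    rw [← Complex.exp_eq_one_iff, ← ha z hz, Complex.exp_sub, hΦ _ hz, hΦ _ (hshift hz),
      Complex.exp_periodic z, div_self]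
    exact h0 _ (hmaps hz)
  -- Subtracting k z removes the monodromy 2πik of the lifted logarithm, so Ψ has period 2πi.
  set Ψ : ℂ → ℂ := fun z ↦ Φ z - k * z with hΨ
  have hΨd : DifferentiableOn ℂ Ψ S := hΦd.sub (by fun_prop)
  have hΨp : ∀ z ∈ S, Ψ (z + 2 * π * I) = Ψ z := by
    intro z hz
    simp only [hΨ]
    linear_combination ha z hz
  have hmemS : ∀ x : ℝ, Real.log r < x → x < 0 → ∀ y : ℝ, (x : ℂ) + y * I ∈ S := by
    intro x h1 h2 y
    simp [hS, h1, h2]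
  -- Cauchy's theorem on a rectangle of height 2π: the horizontal sides cancel by periodicity.
  have hconst : ∀ x₁ x₂ : ℝ, Real.log r < x₁ → x₁ < 0 → Real.log r < x₂ → x₂ < 0 →
      ∫ y in (0:ℝ)..2 * π, Ψ (x₁ + y * I) = ∫ y in (0:ℝ)..2 * π, Ψ (x₂ + y * I) := by
    intro x₁ x₂ h1 h1' h2 h2'
    have hrect := integral_boundary_rect_eq_zero_of_differentiableOn Ψ ⟨x₁, 0⟩ ⟨x₂, 2 * π⟩
      (hΨd.mono (by
        rintro z ⟨hz, -⟩
        simp only [mem_preimage] at hz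
        exact ⟨(lt_min h1 h2).trans_le hz.1, hz.2.trans_lt (max_lt h1' h2')⟩))
    simp only at hrect
    have hcancel : ∫ x : ℝ in x₁..x₂, Ψ (x + ((2 * π : ℝ) : ℂ) * I) =
        ∫ x : ℝ in x₁..x₂, Ψ (x + ((0 : ℝ) : ℂ) * I) := by
      refine intervalIntegral.integral_congr fun x hx ↦ ?_
      have hx1 := (lt_min h1 h2).trans_le hx.1
      have hx2 := hx.2.trans_lt (max_lt h1' h2')
      have := hΨp _ (hmemS x hx1 hx2 0)
      simpa using this
    rw [hcancel, sub_self, zero_add, ← smul_sub, smul_eq_zero] at hrect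
    have := hrect.resolve_left I_ne_zero
    exact (sub_eq_zero.1 this).symm
  have hint : ∀ x : ℝ, Real.log r < x → x < 0 →
      IntervalIntegrable (fun y : ℝ ↦ Ψ (x + y * I)) MeasureTheory.volume 0 (2 * π) := by
    intro x h1 h2
    refine ContinuousOn.intervalIntegrable ?_
    exact hΨd.continuousOn.comp (by fun_prop) fun y _ ↦ hmemS x h1 h2 y
  set x₀ : ℝ := Real.log r / 2
  refine ⟨k, (2 * π)⁻¹ * (∫ y in (0:ℝ)..2 * π, Ψ (x₀ + y * I)).re, ?_⟩
  intro s ⟨hs1, hs2⟩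
  have hs0 : 0 < s := hr0.trans hs1
  have hl1 : Real.log r < Real.log s := Real.log_lt_log hr0 hs1
  have hl2 : Real.log s < 0 := Real.log_neg hs0 hs2
  have hpt : ∀ θ : ℝ, Real.log ‖g (circleMap 0 s θ)‖ =
      (Ψ ((Real.log s : ℝ) + θ * I)).re + k * Real.log s := by
    intro θ
    have hmem := hmemS _ hl1 hl2 θ
    have : circleMap 0 s θ = cexp ((Real.log s : ℝ) + θ * I) := by
      rw [Complex.exp_add, ← ofReal_exp, Real.exp_log hs0]; simp [circleMap]
    rw [this, ← hΦ _ hmem, Complex.norm_exp, Real.log_exp]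
    simp [hΨ]
  rw [circleAverage_def]
  simp_rw [hpt]
  have hcl := (reCLM.intervalIntegral_comp_comm (hint _ hl1 hl2))
  simp only [reCLM_apply] at hcl
  rw [intervalIntegral.integral_add, intervalIntegral.integral_const, hcl,
    hconst _ x₀ hl1 hl2 (by simp only [x₀]; linarith) (by simp only [x₀]; linarith)]
  · generalize (∫ y in (0:ℝ)..2 * π, Ψ (x₀ + y * I)).re = J
    simp only [sub_zero, smul_eq_mul]
    field_simp
    ring
  · have h := hint _ hl1 hl2
    exact ⟨h.1.re, h.2.re⟩
  · exact intervalIntegrable_const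

/-! ### Local properties of injective holomorphic maps -/

/-- A zero of f - f(p) of order m ≥ 2 has the local form φ^m g(p) with φ a local homeomorphism. The
φ-preimages of w and ωw, with ω a primitive m-th root of unity, are then distinct points with the
same image. -/
theorem AnalyticAt.deriv_ne_zero_of_injOn {f : ℂ → ℂ} {p : ℂ} {U : Set ℂ} (hU : U ∈ 𝓝 p)
    (hf : AnalyticAt ℂ f p) (hinj : InjOn f U) : deriv f p ≠ 0 := by
  intro hd
  have hF : AnalyticAt ℂ (fun z ↦ f z - f p) p := hf.sub analyticAt_const
  have hnc : ¬ ∀ᶠ z in 𝓝 p, f z - f p = 0 := by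
    intro h
    have h1 : ∀ᶠ z in 𝓝 p, z = p := by
      filter_upwards [h, hU] with z hz hzU
      exact hinj hzU (mem_of_mem_nhds hU) (sub_eq_zero.1 hz)
    have h2 : ∀ᶠ z in 𝓝[≠] p, z = p := h1.filter_mono nhdsWithin_le_nhds
    have h3 : ∀ᶠ z in 𝓝[≠] p, z ≠ p := eventually_mem_nhdsWithin
    obtain ⟨z, hz1, hz2⟩ := (h2.and h3).exists
    exact hz2 hz1
  obtain ⟨m, g, hg, hg0, hfg⟩ := hF.exists_eventuallyEq_pow_smul_nonzero_iff.2 hnc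
  have hm0 : m ≠ 0 := by
    rintro rfl
    have := hfg.self_of_nhds
    simp at this
    exact hg0 this.symm
  have hm1 : m ≠ 1 := by
    rintro rfl
    have h1 : HasDerivAt (fun z ↦ (z - p) ^ 1 • g z) (g p) p := by
      have := ((hasDerivAt_id p).sub_const p).mul hg.differentiableAt.hasDerivAt
      simpa using! this
    have h2 : HasDerivAt (fun z ↦ f z - f p) 0 p := by
      have := hf.differentiableAt.hasDerivAt.sub_const (f p)
      rwa [hd] at this
    exact hg0 (h1.unique (h2.congr_of_eventuallyEq (EventuallyEq.symm hfg)))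
  -- an `m`-th root of `f - f p`
  set φ : ℂ → ℂ := fun z ↦ (z - p) * (g z / g p) ^ ((m : ℂ)⁻¹) with hφ
  have hφa : AnalyticAt ℂ φ p := by
    refine (analyticAt_id.sub analyticAt_const).mul ?_
    refine AnalyticAt.cpow (hg.div analyticAt_const hg0) analyticAt_const ?_
    rw [div_self hg0]; exact one_mem_slitPlane
  have hφd : HasDerivAt φ 1 p := by
    have h1 : AnalyticAt ℂ (fun z ↦ (g z / g p) ^ ((m : ℂ)⁻¹)) p := by
      refine AnalyticAt.cpow (hg.div analyticAt_const hg0) analyticAt_const ?_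
      rw [div_self hg0]; exact one_mem_slitPlane
    have := ((hasDerivAt_id p).sub_const p).mul h1.differentiableAt.hasDerivAt
    simpa [div_self hg0] using! this
  have hφs : HasStrictDerivAt φ 1 p := by
    have := hφa.hasStrictDerivAt
    rwa [hφd.deriv] at this
  have hφp : φ p = 0 := by simp [hφ]
  have hmap : map φ (𝓝 p) = 𝓝 0 := by rw [← hφp]; exact hφs.map_nhds_eq one_ne_zero
  have hpow : ∀ᶠ z in 𝓝 p, f z - f p = φ z ^ m * g p := by
    filter_upwards [hfg] with z hz
    rw [hz, hφ, mul_pow, ← Complex.cpow_nat_mul, mul_inv_cancel₀ (by exact_mod_cast hm0),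
      cpow_one, smul_eq_mul]
    field_simp
  obtain ⟨ω, hω⟩ : ∃ ω : ℂ, IsPrimitiveRoot ω m := ⟨_, Complex.isPrimitiveRoot_exp m hm0⟩
  have hmem : φ '' {z | z ∈ U ∧ f z - f p = φ z ^ m * g p} ∈ 𝓝 (0 : ℂ) := by
    rw [← hmap]; exact image_mem_map (inter_mem hU hpow)
  have hmem2 : ∀ᶠ w in 𝓝 (0 : ℂ), ω * w ∈ φ '' {z | z ∈ U ∧ f z - f p = φ z ^ m * g p} := by
    have : Tendsto (fun w : ℂ ↦ ω * w) (𝓝 0) (𝓝 0) := by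
      have := (continuous_const_mul ω).tendsto (0 : ℂ)
      rwa [mul_zero] at this
    exact this hmem
  have hE : ∀ᶠ w in 𝓝[≠] (0 : ℂ), w ≠ 0 := eventually_mem_nhdsWithin
  obtain ⟨w, ⟨hw1, hw2⟩, hw0⟩ :=
    (((eventually_mem_set.2 hmem).and hmem2).filter_mono nhdsWithin_le_nhds |>.and hE).exists
  obtain ⟨z₁, ⟨hz₁U, hz₁⟩, e1⟩ := hw1
  obtain ⟨z₂, ⟨hz₂U, hz₂⟩, e2⟩ := hw2
  have hff : f z₁ = f z₂ := by
    rw [e1] at hz₁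
    rw [e2, mul_pow, hω.pow_eq_one, one_mul] at hz₂
    linear_combination hz₁ - hz₂
  have h12 := hinj hz₁U hz₂U hff
  rw [← h12, e1] at e2
  have : ω = 1 := (mul_right_cancel₀ hw0 (by rw [one_mul, ← e2]))
  exact hω.ne_one (by omega) this

/-- An injective holomorphic map pulls compact discs in its image back to compact sets. -/
theorem isCompact_inter_preimage_closedBall {U : Set ℂ} (hU : IsOpen U) (hUc : IsPreconnected U)
    {f : ℂ → ℂ} (hf : DifferentiableOn ℂ f U) (hinj : InjOn f U) (hUn : U.Nontrivial) {t : ℝ}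
    (ht : closedBall 0 t ⊆ f '' U) : IsCompact (U ∩ f ⁻¹' closedBall 0 t) := by
  have hopen : ∀ s ⊆ U, IsOpen s → IsOpen (f '' s) := by
    refine ((hf.analyticOnNhd hU).is_constant_or_isOpen hUc).resolve_left ?_
    rintro ⟨w, hw⟩
    obtain ⟨x, hx, y, hy, hxy⟩ := hUn
    exact hxy (hinj hx hy ((hw x hx).trans (hw y hy).symm))
  -- The inverse is continuous because f is an open map.
  have hinv : ContinuousOn (Function.invFunOn f U) (closedBall 0 t) := by
    intro w hw
    refine ContinuousAt.continuousWithinAt ?_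
    have hw1 := Function.invFunOn_mem (ht hw)
    have hw2 := Function.invFunOn_eq (ht hw)
    intro V hV
    obtain ⟨V', hV', hV'o, hwV'⟩ := _root_.mem_nhds_iff.1 (inter_mem hV (hU.mem_nhds hw1))
    have : f '' V' ∈ 𝓝 w :=
      (hopen V' (fun x hx ↦ (hV' hx).2) hV'o).mem_nhds ⟨_, hwV', hw2⟩
    rw [mem_map]
    filter_upwards [this]
    rintro _ ⟨x, hx, rfl⟩
    have hxU := (hV' hx).2
    show Function.invFunOn f U (f x) ∈ V
    rw [hinj.leftInvOn_invFunOn hxU]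
    exact (hV' hx).1
  have : U ∩ f ⁻¹' closedBall 0 t = Function.invFunOn f U '' closedBall 0 t := by
    ext z
    constructor
    · rintro ⟨hz, hfz⟩
      exact ⟨f z, hfz, hinj.leftInvOn_invFunOn hz⟩
    · rintro ⟨w, hw, rfl⟩
      refine ⟨Function.invFunOn_mem (ht hw), ?_⟩
      rw [mem_preimage, Function.invFunOn_eq (ht hw)]
      exact hw
  rw [this]
  exact (isCompact_closedBall _ _).image_of_continuousOn hinv

/-! ### Upper bound for the squeezing radius -/

theorem exists_circleAverage_log_norm_eq_of_embedding {r : ℝ} (hr0 : 0 < r) {ρ : ℝ}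
    (hρ : ρ ∈ Ioo r 1) {f : ℂ → ℂ} (hf : IsHolomorphicEmbeddingIntoBall (annulus r) (ρ : ℂ) f) :
    ∃ (k : ℤ) (c : ℝ), ∀ s ∈ Ioo r 1, s ≠ ρ →
      CircleIntegrable (fun z ↦ Real.log ‖f z‖) 0 s ∧
      circleAverage (fun z ↦ Real.log ‖f z‖) 0 s =
        Real.log (max s ρ) + k * Real.log s + c := by
  have hρ0 : 0 < ρ := hr0.trans hρ.1
  have hr1 : r < 1 := hρ.1.trans hρ.2
  have hAo := isOpen_annulus r
  have hρA : (ρ : ℂ) ∈ annulus r := by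
    simp only [annulus, mem_ofPred_eq, norm_real, Real.norm_of_nonneg hρ0.le]
    exact hρ
  have hAn := hAo.mem_nhds hρA
  set g := dslope f (ρ : ℂ) with hg
  have hgd : DifferentiableOn ℂ g (annulus r) :=
    (Complex.differentiableOn_dslope hAn).2 hf.differentiableOn
  have hfg : ∀ z, f z = (z - ρ) * g z := by
    intro z
    have := sub_smul_dslope f (ρ : ℂ) z
    rw [hf.map_base, sub_zero, smul_eq_mul] at this
    exact this.symm
  have hf0 : ∀ z ∈ annulus r, z ≠ ρ → f z ≠ 0 := by
    intro z hz hzρ h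
    exact hzρ (hf.injOn hz hρA (h.trans hf.map_base.symm))
  have hg0 : ∀ z ∈ annulus r, g z ≠ 0 := by
    intro z hz h
    by_cases hzρ : z = ρ
    · rw [hzρ, hg, dslope_same] at h
      exact AnalyticAt.deriv_ne_zero_of_injOn hAn (hf.differentiableOn.analyticAt hAn) hf.injOn h
    · exact hf0 z hz hzρ (by rw [hfg, h, mul_zero])
  obtain ⟨k, c, hkc⟩ := exists_circleAverage_log_norm_eq hr0 hr1 hgd hg0
  refine ⟨k, c, fun s hs hsρ ↦ ?_⟩
  have hs0 : 0 < s := hr0.trans hs.1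
  have hsph : ∀ z ∈ sphere (0 : ℂ) s, z ∈ annulus r ∧ z ≠ ρ := by
    intro z hz
    rw [mem_sphere_zero_iff_norm] at hz
    refine ⟨by simpa [annulus, hz] using hs, ?_⟩
    rintro rfl
    rw [norm_real, Real.norm_of_nonneg hρ0.le] at hz
    exact hsρ hz.symm
  have i1 : CircleIntegrable (fun z : ℂ ↦ Real.log ‖z - ρ‖) 0 s := by
    refine ContinuousOn.circleIntegrable hs0.le ?_
    exact ContinuousOn.log (by fun_prop) fun z hz ↦ norm_ne_zero_iff.2 (sub_ne_zero.2 (hsph z hz).2)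
  have i2 : CircleIntegrable (fun z : ℂ ↦ Real.log ‖g z‖) 0 s := by
    refine ContinuousOn.circleIntegrable hs0.le ?_
    exact ContinuousOn.log (hgd.continuousOn.mono fun z hz ↦ (hsph z hz).1).norm
      fun z hz ↦ norm_ne_zero_iff.2 (hg0 z (hsph z hz).1)
  have i3 : CircleIntegrable (fun z : ℂ ↦ Real.log ‖f z‖) 0 s := by
    refine ContinuousOn.circleIntegrable hs0.le ?_
    exact ContinuousOn.log (hf.differentiableOn.continuousOn.mono fun z hz ↦ (hsph z hz).1).norm
      fun z hz ↦ norm_ne_zero_iff.2 (hf0 z (hsph z hz).1 (hsph z hz).2)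
  refine ⟨i3, ?_⟩
  have e1 : circleAverage (fun z ↦ Real.log ‖f z‖) 0 s =
      circleAverage (fun z ↦ Real.log ‖z - ρ‖ + Real.log ‖g z‖) 0 s := by
    refine circleAverage_congr_sphere fun z hz ↦ ?_
    rw [abs_of_pos hs0] at hz
    rw [hfg, norm_mul, Real.log_mul (norm_ne_zero_iff.2 (sub_ne_zero.2 (hsph z hz).2))
      (norm_ne_zero_iff.2 (hg0 z (hsph z hz).1))]
  rw [e1, circleAverage_fun_add i1 i2, hkc s hs,
    circleAverage_log_norm_sub_const_eq_log_radius_add_posLog hs0.ne', ← add_assoc]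
  congr 2
  -- What remains is log s + log⁺(ρ/s) = log max(s, ρ).
  rw [zero_sub, norm_neg, norm_real, Real.norm_of_nonneg hρ0.le]
  rcases le_total ρ s with h | h
  · rw [max_eq_left h, Real.posLog_eq_zero_iff _ |>.2, add_zero]
    rw [abs_of_pos (by positivity), inv_mul_le_one₀ hs0]
    exact h
  · rw [max_eq_right h, Real.posLog_eq_log, Real.log_mul (by positivity) hρ0.ne', Real.log_inv]
    · ring
    · rw [abs_of_pos (by positivity), le_inv_mul_iff₀ hs0]
      simpa using h

theorem squeezingRadius_annulus_le {r : ℝ} (hr0 : 0 < r) {ρ : ℝ} (hρ : ρ ∈ Ioo r 1) {f : ℂ → ℂ}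
    (hf : IsHolomorphicEmbeddingIntoBall (annulus r) (ρ : ℂ) f) :
    squeezingRadius (annulus r) f ≤ max ρ (r / ρ) := by
  have hρ0 : 0 < ρ := hr0.trans hρ.1
  have hr1 : r < 1 := hρ.1.trans hρ.2
  have hρA : (ρ : ℂ) ∈ annulus r := by
    simp only [annulus, mem_ofPred_eq, norm_real, Real.norm_of_nonneg hρ0.le]
    exact hρ
  -- Radius 0 is admissible because its open ball is empty.
  refine csSup_le ⟨0, by simp⟩ fun t ht ↦ ?_
  refine le_of_forall_lt_imp_le_of_dense fun t' ht' ↦ ?_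
  rcases le_or_gt t' 0 with h0 | h0
  · exact h0.trans (hρ0.le.trans (le_max_left _ _))
  -- Shrinking to t' < t puts a closed disc in the image. Its preimage is compact, so it stays away
  -- from both boundary circles; z₁ and z₂ record its extreme moduli.
  have hK := isCompact_inter_preimage_closedBall (isOpen_annulus r) (isPreconnected_annulus hr0)
    hf.differentiableOn hf.injOn (t := t') ⟨ρ, hρA, ((ρ + 1) / 2 : ℝ), by
      simp only [annulus, mem_ofPred_eq, norm_real, Real.norm_of_nonneg (show 0 ≤ (ρ + 1) / 2 by
        linarith)]
      constructor <;> linarith [hρ.1, hρ.2], by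
      rw [Ne, ofReal_inj]; linarith [hρ.2]⟩
    ((closedBall_subset_ball ht').trans ht)
  have hKne : (annulus r ∩ f ⁻¹' closedBall 0 t').Nonempty :=
    ⟨ρ, hρA, by rw [mem_preimage, hf.map_base]; exact mem_closedBall_self h0.le⟩
  obtain ⟨z₁, hz₁, hmin⟩ := hK.exists_isMinOn hKne continuous_norm.continuousOn
  obtain ⟨z₂, hz₂, hmax⟩ := hK.exists_isMaxOn hKne continuous_norm.continuousOn
  obtain ⟨k, c, hkc⟩ := exists_circleAverage_log_norm_eq_of_embedding hr0 hρ hf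
  have hupper : ∀ s ∈ Ioo r 1, s ≠ ρ → Real.log (max s ρ) + k * Real.log s + c ≤ 0 := by
    intro s hs hsρ
    obtain ⟨h1, h2⟩ := hkc s hs hsρ
    rw [← h2]
    refine circleAverage_mono_on_of_le_circle h1 fun z hz ↦ ?_
    rw [abs_of_pos (hr0.trans hs.1), mem_sphere_zero_iff_norm] at hz
    have := hf.mapsTo (show z ∈ annulus r by simpa [annulus, hz] using hs)
    rw [mem_ball_zero_iff] at this
    exact Real.log_nonpos (norm_nonneg _) this.le
  have hlower : ∀ s ∈ Ioo r 1, s ≠ ρ → (s < ‖z₁‖ ∨ ‖z₂‖ < s) →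
      Real.log t' ≤ Real.log (max s ρ) + k * Real.log s + c := by
    intro s hs hsρ hs12
    obtain ⟨h1, h2⟩ := hkc s hs hsρ
    rw [← h2, ← circleAverage_const (Real.log t') 0 s]
    refine circleAverage_mono (circleIntegrable_const _ _ _) h1 fun z hz ↦ ?_
    rw [abs_of_pos (hr0.trans hs.1), mem_sphere_zero_iff_norm] at hz
    have hzA : z ∈ annulus r := by simpa [annulus, hz] using hs
    refine Real.log_le_log h0 (le_of_not_ge fun hle ↦ ?_)
    have hzK : z ∈ annulus r ∩ f ⁻¹' closedBall 0 t' := ⟨hzA, by simpa using hle⟩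
    have m1 := hmin hzK
    have m2 := hmax hzK
    simp only [mem_ofPred_eq, hz] at m1 m2
    rcases hs12 with h | h <;> linarith
  have hcont : ∀ s₀ > 0, Tendsto (fun s ↦ Real.log (max s ρ) + k * Real.log s + c) (𝓝 s₀)
      (𝓝 (Real.log (max s₀ ρ) + k * Real.log s₀ + c)) := by
    intro s₀ hs₀
    have : ContinuousAt (fun s ↦ Real.log (max s ρ) + k * Real.log s + c) s₀ := by
      refine ((ContinuousAt.log (by fun_prop) ?_).add
        (continuousAt_const.mul (ContinuousAt.log continuousAt_id hs₀.ne'))).add continuousAt_const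
      exact (hρ0.trans_le (le_max_right _ _)).ne'
    exact this
  have ev_r : ∀ᶠ s in 𝓝[>] r, s ∈ Ioo r 1 ∧ s ≠ ρ ∧ (s < ‖z₁‖ ∨ ‖z₂‖ < s) := by
    filter_upwards [Ioo_mem_nhdsGT hr1, Ioo_mem_nhdsGT hρ.1, Ioo_mem_nhdsGT hz₁.1.1]
      with s h1 h2 h3
    exact ⟨h1, h2.2.ne, Or.inl h3.2⟩
  have ev_1 : ∀ᶠ s in 𝓝[<] (1 : ℝ), s ∈ Ioo r 1 ∧ s ≠ ρ ∧ (s < ‖z₁‖ ∨ ‖z₂‖ < s) := by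
    filter_upwards [Ioo_mem_nhdsLT hr1, Ioo_mem_nhdsLT hρ.2, Ioo_mem_nhdsLT hz₂.1.2]
      with s h1 h2 h3
    exact ⟨h1, h2.1.ne', Or.inr h3.1⟩
  have lim_r := (hcont r hr0).mono_left (nhdsWithin_le_nhds (s := Ioi r))
  have lim_1 := (hcont 1 one_pos).mono_left (nhdsWithin_le_nhds (s := Iio 1))
  rw [max_eq_right hρ.1.le] at lim_r
  rw [max_eq_left hρ.2.le, Real.log_one, mul_zero, zero_add, zero_add] at lim_1
  have lo_r := ge_of_tendsto lim_r (ev_r.mono fun s h ↦ hlower s h.1 h.2.1 h.2.2)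
  have lo_1 := ge_of_tendsto lim_1 (ev_1.mono fun s h ↦ hlower s h.1 h.2.1 h.2.2)
  have up_r := le_of_tendsto lim_r (ev_r.mono fun s h ↦ hupper s h.1 h.2.1)
  have up_1 := le_of_tendsto lim_1 (ev_1.mono fun s h ↦ hupper s h.1 h.2.1)
  have hlogr : Real.log r < 0 := Real.log_neg hr0 hr1
  -- Integrality of k leaves no gap between the cases. For k ≥ 0, use c ≤ 0 in the lower bound at r;
  -- for k ≤ -1, the upper bound at r gives c ≤ log r - log ρ.
  rcases le_or_gt 0 k with hk | hk
  · have hk' : (0 : ℝ) ≤ k := by exact_mod_cast hk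
    refine le_max_of_le_left ((Real.log_le_log_iff h0 hρ0).1 ?_)
    nlinarith
  · have hk' : (k : ℝ) ≤ -1 := by exact_mod_cast Int.le_sub_one_of_lt hk
    refine le_max_of_le_right ((Real.log_le_log_iff h0 (by positivity)).1 ?_)
    rw [Real.log_div hr0.ne' hρ0.ne']
    nlinarith

/-! ### The argument principle on a closed annulus -/

theorem isPreconnected_closedAnnulus {r R : ℝ} (hr : 0 < r) (hR : 0 < R) :
    IsPreconnected (closedBall (0 : ℂ) R \ ball 0 r) := by
  have : closedBall (0 : ℂ) R \ ball 0 r =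
      cexp '' {z : ℂ | Real.log r ≤ z.re ∧ z.re ≤ Real.log R} := by
    ext z
    simp only [Set.mem_sdiff, mem_closedBall_zero_iff, mem_ball_zero_iff, not_lt, mem_image,
      mem_ofPred_eq]
    constructor
    · rintro ⟨h1, h2⟩
      have hz : 0 < ‖z‖ := hr.trans_le h2
      refine ⟨Complex.log z, ?_, Complex.exp_log (norm_pos_iff.1 hz)⟩
      rw [Complex.log_re]
      exact ⟨Real.log_le_log hr h2, Real.log_le_log hz h1⟩
    · rintro ⟨w, ⟨hw1, hw2⟩, rfl⟩
      rw [Complex.norm_exp]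
      have h1 := (Real.log_le_iff_le_exp hr).1 hw1
      exact ⟨(Real.le_log_iff_exp_le hR).1 hw2, h1⟩
  rw [this]
  exact ((convex_halfSpace_re_ge _).inter (convex_halfSpace_re_le _)).isPreconnected.image _
    continuous_exp.continuousOn

theorem circleIntegral_inv_sub_eq_zero {R : ℝ} (hR : 0 ≤ R) {u : ℂ} (hu : R < ‖u‖) :
    (∮ z in C(0, R), (z - u)⁻¹) = 0 := by
  refine circleIntegral_eq_zero_of_differentiable_on_off_countable hR countable_empty ?_ ?_
  · refine ContinuousOn.inv₀ (by fun_prop) fun z hz ↦ ?_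
    rw [mem_closedBall_zero_iff] at hz
    rintro h
    rw [sub_eq_zero.1 h] at hz
    linarith
  · intro z hz
    refine DifferentiableAt.inv (by fun_prop) ?_
    have := hz.1
    rw [mem_ball_zero_iff] at this
    rintro h
    rw [sub_eq_zero.1 h] at this
    linarith

/-- The argument principle on an annulus. -/
theorem exists_circleIntegral_logDeriv_sub_eq {r R : ℝ} (hr : 0 < r) (hrR : r < R) {F : ℂ → ℂ}
    (hF : AnalyticOnNhd ℂ F (closedBall 0 R \ ball 0 r))
    (hFr : ∀ z ∈ sphere (0 : ℂ) r, F z ≠ 0) (hFR : ∀ z ∈ sphere (0 : ℂ) R, F z ≠ 0) :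
    ∃ (Z : Finset ℂ) (n : ℂ → ℤ), (∀ u, u ∈ Z ↔ (r < ‖u‖ ∧ ‖u‖ < R) ∧ F u = 0) ∧
      (∀ u ∈ Z, 1 ≤ n u) ∧
      (∮ z in C(0, R), logDeriv F z) - (∮ z in C(0, r), logDeriv F z) =
        2 * π * I * ((∑ u ∈ Z, n u : ℤ) : ℂ) := by
  classical
  set U : Set ℂ := closedBall 0 R \ ball 0 r with hU
  have hR : 0 < R := hr.trans hrR
  have hmemU : ∀ z, z ∈ U ↔ r ≤ ‖z‖ ∧ ‖z‖ ≤ R := by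
    intro z; simp [hU, and_comm]
  have hUc : IsPreconnected U := isPreconnected_closedAnnulus hr hR
  have hUcomp : IsCompact U := IsCompact.diff (isCompact_closedBall _ _) isOpen_ball
  have hrU : ((r : ℝ) : ℂ) ∈ U := by
    rw [hmemU, norm_real, Real.norm_of_nonneg hr.le]; exact ⟨le_rfl, hrR.le⟩
  have hRU : ((R : ℝ) : ℂ) ∈ U := by
    rw [hmemU, norm_real, Real.norm_of_nonneg hR.le]; exact ⟨hrR.le, le_rfl⟩
  have hUn : U.Nontrivial := ⟨r, hrU, R, hRU, by rw [Ne, ofReal_inj]; exact hrR.ne⟩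
  have hUp : Preperfect U := hUc.preperfect_of_nontrivial hUn
  have hFm : MeromorphicOn F U := fun z hz ↦ (hF z hz).meromorphicAt
  have hord0 : ∀ z ∈ U, F z ≠ 0 → meromorphicOrderAt F z = 0 := by
    intro z hz hne
    rw [(hF z hz).meromorphicOrderAt_eq, (hF z hz).analyticOrderAt_eq_zero.2 hne]
    simp
  have hordtop : ∀ z ∈ U, meromorphicOrderAt F z ≠ ⊤ := by
    intro z hz
    refine hFm.meromorphicOrderAt_ne_top_of_isPreconnected hUc hrU hz ?_
    rw [hord0 _ hrU (hFr _ (by simp [abs_of_pos hr]))]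
    exact WithTop.zero_ne_top
  set D := MeromorphicOn.divisor F U with hD
  have hDfin : (D : ℂ → ℤ).support.Finite := D.finiteSupport hUcomp
  have hDnn : ∀ u, 0 ≤ D u := fun u ↦ MeromorphicOn.AnalyticOnNhd.divisor_nonneg hF u
  have hDapp : ∀ u ∈ U, D u = (meromorphicOrderAt F u).untop₀ := fun u hu ↦
    MeromorphicOn.divisor_apply hFm hu
  have hD0 : ∀ u ∈ U, (D u = 0 ↔ F u ≠ 0) := by
    intro u hu
    constructor
    · intro h h0
      rw [hDapp u hu] at h
      rcases WithTop.untop₀_eq_zero.1 h with h | h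
      · rw [(hF u hu).meromorphicOrderAt_eq] at h
        have h1 : analyticOrderAt F u ≠ 0 := fun h2 ↦ (hF u hu).analyticOrderAt_eq_zero.1 h2 h0
        revert h h1
        cases analyticOrderAt F u <;> simp
      · exact hordtop u hu h
    · intro h
      rw [hDapp u hu, hord0 u hu h]; rfl
  have hDU : ∀ u, D u ≠ 0 → u ∈ U := fun u hu ↦ D.supportWithinDomain hu
  set Z := hDfin.toFinset with hZ
  have hZmem : ∀ u, u ∈ Z ↔ (r < ‖u‖ ∧ ‖u‖ < R) ∧ F u = 0 := by
    intro u
    rw [hZ, Finite.mem_toFinset, Function.mem_support]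
    constructor
    · intro h
      have hu := hDU u h
      have hFu : F u = 0 := by
        by_contra h0
        exact h ((hD0 u hu).2 h0)
      obtain ⟨h1, h2⟩ := (hmemU u).1 hu
      refine ⟨⟨lt_of_le_of_ne h1 fun e ↦ ?_, lt_of_le_of_ne h2 fun e ↦ ?_⟩, hFu⟩
      · exact hFr u (by simp [e]) hFu
      · exact hFR u (by simp [e]) hFu
    · rintro ⟨⟨h1, h2⟩, h3⟩ h
      exact (hD0 u ((hmemU u).2 ⟨h1.le, h2.le⟩)).1 h h3
  refine ⟨Z, D, hZmem, fun u hu ↦ ?_, ?_⟩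
  · rw [hZ, Finite.mem_toFinset, Function.mem_support] at hu
    have := hDnn u
    omega
  -- Divide out the zeros: F = ∏ (z - u)^{D u} · g with g analytic and zero-free. The equality first
  -- holds on a codiscrete set, then near every point of U by continuity, as U has no isolated
  -- points.
  obtain ⟨g, hg, hg0, hFg⟩ := hFm.extract_zeros_poles (fun u ↦ hordtop u u.2) hDfin
  rw [Function.FactorizedRational.finprod_eq_fun hDfin] at hFg
  have hprod : ∀ x : ℂ, (∏ᶠ u, (x - u) ^ D u) = ∏ u ∈ Z, (x - u) ^ D u := by
    intro x
    refine finprod_eq_prod_of_mulSupport_subset _ fun u hu ↦ ?_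
    rw [hZ, Finite.coe_toFinset, Function.mem_support]
    intro h
    simp [h] at hu
  simp_rw [hprod] at hFg
  have hPa : ∀ x, AnalyticAt ℂ (fun x : ℂ ↦ ∏ u ∈ Z, (x - u) ^ D u) x := fun x ↦ by
    refine Finset.analyticAt_fun_prod _ fun u _ ↦ ?_
    exact AnalyticAt.fun_zpow_nonneg (by fun_prop) (hDnn u)
  have heq : ∀ x ∈ U, F =ᶠ[𝓝 x] fun z ↦ (∏ u ∈ Z, (z - u) ^ D u) * g z := by
    intro x hx
    have ha : AnalyticAt ℂ (fun z ↦ (∏ u ∈ Z, (z - u) ^ D u) * g z) x := (hPa x).mul (hg x hx)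
    have := (hFm x hx).eventuallyEq_nhdsNE_of_eventuallyEq_codiscreteWithin
      ha.meromorphicAt hx (hUp x hx) hFg
    exact ((hF x hx).continuousAt.eventuallyEq_nhds_iff_eventuallyEq_nhdsNE ha.continuousAt).1 this
  have hlog : ∀ x ∈ U, F x ≠ 0 → logDeriv F x = ∑ u ∈ Z, D u * (x - u)⁻¹ + logDeriv g x := by
    intro x hx hFx
    have hxu : ∀ u ∈ Z, x - u ≠ 0 := by
      intro u hu h
      rw [sub_eq_zero] at h
      exact hFx (h ▸ ((hZmem u).1 hu).2)
    have hcongr : logDeriv F x = logDeriv (fun z ↦ (∏ u ∈ Z, (z - u) ^ D u) * g z) x := by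
      rw [logDeriv_apply, logDeriv_apply, EventuallyEq.deriv_eq (heq x hx), (heq x hx).self_of_nhds]
    rw [hcongr]
    rw [logDeriv_mul x (Finset.prod_ne_zero_iff.2 fun u hu ↦ zpow_ne_zero _ (hxu u hu)) (hg0 ⟨x, hx⟩)
      (hPa x).differentiableAt (hg x hx).differentiableAt]
    rw [logDeriv_prod (s := Z) (f := fun u z ↦ (z - u) ^ D u) (x := x)
      (fun u hu ↦ zpow_ne_zero _ (hxu u hu)) fun u hu ↦
      (AnalyticAt.fun_zpow_nonneg (𝕜 := ℂ) (by fun_prop) (hDnn u)).differentiableAt]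
    congr 1
    refine Finset.sum_congr rfl fun u hu ↦ ?_
    rw [logDeriv_fun_zpow (by fun_prop)]
    congr 1
    rw [logDeriv_apply, deriv_sub_const, deriv_id'', one_div]
  have hgd : ∀ z ∈ U, DifferentiableAt ℂ (logDeriv g) z := fun z hz ↦
    ((hg z hz).deriv.div (hg z hz) (hg0 ⟨z, hz⟩)).differentiableAt
  have hgint : (∮ z in C(0, R), logDeriv g z) = ∮ z in C(0, r), logDeriv g z := by
    refine circleIntegral_eq_of_differentiable_on_annulus_off_countable hr hrR.le countable_empty
      (fun z hz ↦ (hgd z hz).continuousAt.continuousWithinAt) fun z hz ↦ hgd z ?_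
    exact ⟨ball_subset_closedBall hz.1.1, fun h ↦ hz.1.2 (ball_subset_closedBall h)⟩
  have hint : ∀ s, 0 < s → (∀ z ∈ sphere (0 : ℂ) s, z ∈ U ∧ F z ≠ 0) →
      (∮ z in C(0, s), logDeriv F z) =
        ∑ u ∈ Z, D u * (∮ z in C(0, s), (z - u)⁻¹) + ∮ z in C(0, s), logDeriv g z := by
    intro s hs hsU
    rw [circleIntegral.integral_congr hs.le fun z hz ↦ hlog z (hsU z hz).1 (hsU z hz).2]
    have hi : ∀ u ∈ Z, CircleIntegrable (fun z ↦ (D u : ℂ) * (z - u)⁻¹) 0 s := by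
      intro u hu
      refine ContinuousOn.circleIntegrable hs.le ?_
      refine continuousOn_const.mul (ContinuousOn.inv₀ (by fun_prop) fun z hz h ↦ ?_)
      rw [sub_eq_zero] at h
      exact (hsU z hz).2 (h ▸ ((hZmem u).1 hu).2)
    rw [circleIntegral.integral_add (CircleIntegrable.fun_sum _ hi)
      (ContinuousOn.circleIntegrable hs.le fun z hz ↦
        (hgd z (hsU z hz).1).continuousAt.continuousWithinAt),
      circleIntegral.integral_fun_sum hi]
    simp_rw [circleIntegral.integral_const_mul]
  have hsphU : ∀ s, r ≤ s → s ≤ R → ∀ z ∈ sphere (0 : ℂ) s, z ∈ U := by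
    intro s h1 h2 z hz
    rw [mem_sphere_zero_iff_norm] at hz
    rw [hmemU, hz]
    exact ⟨h1, h2⟩
  have hA : ∑ u ∈ Z, (D u : ℂ) * (∮ z in C(0, R), (z - u)⁻¹) =
      2 * π * I * ((∑ u ∈ Z, D u : ℤ) : ℂ) := by
    push_cast
    rw [Finset.mul_sum]
    refine Finset.sum_congr rfl fun u hu ↦ ?_
    rw [circleIntegral.integral_sub_inv_of_mem_ball
      (by rw [mem_ball_zero_iff]; exact ((hZmem u).1 hu).1.2), mul_comm]
  have hB : ∑ u ∈ Z, (D u : ℂ) * (∮ z in C(0, r), (z - u)⁻¹) = 0 :=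
    Finset.sum_eq_zero fun u hu ↦ by
      rw [circleIntegral_inv_sub_eq_zero hr.le ((hZmem u).1 hu).1.1, mul_zero]
  rw [hint R hR fun z hz ↦ ⟨hsphU R hrR.le le_rfl z hz, hFR z hz⟩,
    hint r hr fun z hz ↦ ⟨hsphU r le_rfl hrR.le z hz, hFr z hz⟩, hgint, hA, hB]
  ring

/-! ### The q-logarithm -/

/-- The series `∑ xⁿ / (n (1 - qⁿ))`, that is `-log (∏ (1 - qᵏ x))` over `k ≥ 0`. -/
noncomputable def qLog (q : ℝ) (x : ℂ) : ℂ := ∑' n : ℕ, x ^ (n + 1) / ((n + 1) * (1 - q ^ (n + 1)))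

theorem norm_qLog_term_le {q : ℝ} (hq0 : 0 < q) (hq1 : q < 1) {x : ℂ} {s : ℝ} (hx : ‖x‖ ≤ s)
    (n : ℕ) : ‖x ^ (n + 1) / ((n + 1) * (1 - (q : ℂ) ^ (n + 1)))‖ ≤ s ^ (n + 1) * (1 - q)⁻¹ := by
  have hs : 0 ≤ s := (norm_nonneg x).trans hx
  have h1 : (((n : ℂ) + 1) * (1 - (q : ℂ) ^ (n + 1))) =
      (((n + 1) * (1 - q ^ (n + 1)) : ℝ) : ℂ) := by push_cast; ring
  have h2 : q ^ (n + 1) ≤ q := by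
    rw [pow_succ]; exact mul_le_of_le_one_left hq0.le (pow_le_one₀ hq0.le hq1.le)
  have h3 : 1 - q ≤ (n + 1) * (1 - q ^ (n + 1)) := by
    have : (0 : ℝ) ≤ n := n.cast_nonneg
    nlinarith
  have h4 : 0 < 1 - q := by linarith
  rw [h1, norm_div, norm_pow, norm_real, Real.norm_of_nonneg (h4.le.trans h3), div_eq_mul_inv]
  gcongr
  exact inv_nonneg.2 (h4.le.trans h3)

theorem summable_qLog {q : ℝ} (hq0 : 0 < q) (hq1 : q < 1) {x : ℂ} (hx : ‖x‖ < 1) :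
    Summable fun n : ℕ ↦ x ^ (n + 1) / ((n + 1) * (1 - (q : ℂ) ^ (n + 1))) := by
  refine Summable.of_norm_bounded ?_ (norm_qLog_term_le hq0 hq1 le_rfl)
  exact ((summable_nat_add_iff 1).2 (summable_geometric_of_lt_one (norm_nonneg _) hx)).mul_right _

theorem differentiableAt_qLog {q : ℝ} (hq0 : 0 < q) (hq1 : q < 1) {x : ℂ} (hx : ‖x‖ < 1) :
    DifferentiableAt ℂ (qLog q) x := by
  obtain ⟨s, hs1, hs2⟩ := exists_between hx
  have : DifferentiableOn ℂ (qLog q) (ball 0 s) := by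
    refine differentiableOn_tsum_of_summable_norm
      (u := fun n : ℕ ↦ s ^ (n + 1) * (1 - q)⁻¹) ?_ (fun n ↦ by fun_prop) isOpen_ball ?_
    · exact ((summable_nat_add_iff 1).2
        (summable_geometric_of_lt_one ((norm_nonneg _).trans hs1.le) hs2)).mul_right _
    · intro n w hw
      exact norm_qLog_term_le hq0 hq1 (mem_ball_zero_iff.1 hw).le n
  exact this.differentiableAt (isOpen_ball.mem_nhds (mem_ball_zero_iff.2 hs1))

/-- The difference multiplies the n-th term by 1 - qⁿ, cancelling the denominator and leaving the
series of -log(1 - x). In product form this is P(x) = (1 - x)P(qx). -/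
theorem qLog_sub_qLog_mul {q : ℝ} (hq0 : 0 < q) (hq1 : q < 1) {x : ℂ} (hx : ‖x‖ < 1) :
    qLog q x - qLog q (q * x) = -Complex.log (1 - x) := by
  have hqx : ‖q * x‖ < 1 := by
    rw [norm_mul, norm_real, Real.norm_of_nonneg hq0.le]
    exact mul_lt_one_of_nonneg_of_lt_one_left hq0.le hq1 hx.le
  have h1 := hasSum_taylorSeries_neg_log hx
  rw [← hasSum_nat_add_iff' 1] at h1
  simp only [Finset.range_one, Finset.sum_singleton, Nat.cast_zero, div_zero, sub_zero] at h1
  rw [← h1.tsum_eq, qLog, qLog, ← (summable_qLog hq0 hq1 hx).tsum_sub (summable_qLog hq0 hq1 hqx)]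
  refine tsum_congr fun n ↦ ?_
  have h2 : (1 : ℂ) - (q : ℂ) ^ (n + 1) ≠ 0 := by
    have : q ^ (n + 1) < 1 := pow_lt_one₀ hq0.le hq1 (by omega)
    rw [← ofReal_pow, ← ofReal_one, ← ofReal_sub, Ne, ofReal_eq_zero]
    linarith
  have h3 : (n : ℂ) + 1 ≠ 0 := by exact_mod_cast n.succ_ne_zero
  push_cast
  rw [mul_pow]
  field_simp

theorem qLog_conj (q : ℝ) (x : ℂ) : qLog q (conj x) = conj (qLog q x) := by
  rw [qLog, qLog, conj_tsum]
  refine tsum_congr fun n ↦ ?_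
  simp

theorem qLog_conj_re (q : ℝ) (x : ℂ) : (qLog q (conj x)).re = (qLog q x).re := by
  rw [qLog_conj, conj_re]

/-! ### The slit map and its boundary moduli -/

/-- The exponent of the conformal map of the annulus `r < ‖z‖ < 1` onto the unit disc slit along
an arc of the circle of radius `ρ`. -/
noncomputable def slitExponent (r ρ : ℝ) (z : ℂ) : ℂ :=
  qLog (r ^ 2) (ρ * z) + qLog (r ^ 2) (r ^ 2 / (ρ * z)) - qLog (r ^ 2) (r ^ 2 * (z / ρ)) -
    qLog (r ^ 2) (r ^ 2 * (ρ / z))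

/-- The conformal map of the annulus `r < ‖z‖ < 1` onto the unit disc slit along an arc of the
circle of radius `ρ`. -/
noncomputable def slitMap (r ρ : ℝ) (z : ℂ) : ℂ := (z - ρ) * cexp (slitExponent r ρ z)

/-- The two logarithmic derivatives differ by that of 1 - w/f, which stays in the disc of radius 1
about 1 and so has a single-valued logarithm. -/
theorem circleIntegral_logDeriv_sub_const_of_lt {f : ℂ → ℂ} {s : ℝ} (hs : 0 < s) {w : ℂ}
    (hf : AnalyticOnNhd ℂ f (sphere 0 s)) (hw : ∀ z ∈ sphere (0 : ℂ) s, ‖w‖ < ‖f z‖) :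
    (∮ z in C(0, s), logDeriv (fun z ↦ f z - w) z) = ∮ z in C(0, s), logDeriv f z := by
  have hf0 : ∀ z ∈ sphere (0 : ℂ) s, f z ≠ 0 := fun z hz h ↦ by
    have := hw z hz
    rw [h, norm_zero] at this
    exact absurd this (norm_nonneg w).not_gt
  have hfw : ∀ z ∈ sphere (0 : ℂ) s, f z - w ≠ 0 := fun z hz h ↦ by
    have := hw z hz
    rw [sub_eq_zero.1 h] at this
    exact lt_irrefl _ this
  have i1 : CircleIntegrable (logDeriv fun z ↦ f z - w) 0 s :=
    ContinuousOn.circleIntegrable hs.le fun z hz ↦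
      (((hf z hz).sub analyticAt_const).deriv.div ((hf z hz).sub analyticAt_const)
        (hfw z hz)).continuousAt.continuousWithinAt
  have i2 : CircleIntegrable (logDeriv f) 0 s :=
    ContinuousOn.circleIntegrable hs.le fun z hz ↦
      ((hf z hz).deriv.div (hf z hz) (hf0 z hz)).continuousAt.continuousWithinAt
  rw [← sub_eq_zero, ← circleIntegral.integral_sub i1 i2]
  refine circleIntegral.integral_eq_zero_of_hasDerivWithinAt (f := fun z ↦ Complex.log (1 - w / f z))
    hs.le fun z hz ↦ HasDerivAt.hasDerivWithinAt ?_
  have hd := (hf z hz).differentiableAt.hasDerivAt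
  have hslit : 1 - w / f z ∈ slitPlane := by
    rw [sub_eq_add_neg]
    refine mem_slitPlane_of_norm_lt_one ?_
    rw [norm_neg, norm_div, div_lt_one (norm_pos_iff.2 (hf0 z hz))]
    exact hw z hz
  have h := (((hasDerivAt_const z w).div hd (hf0 z hz)).const_sub 1).clog hslit
  convert! h using 1
  rw [logDeriv_apply, logDeriv_apply, deriv_sub_const]
  have h1 := hf0 z hz
  have h2 := hfw z hz
  have h3 : f z - w = f z * (1 - w / f z) := by field_simp
  have h4 : 1 - w / f z ≠ 0 := fun h ↦ h2 (by rw [h3, h, mul_zero])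
  simp only [Pi.div_apply]
  rw [div_sub_div _ _ h2 h1, div_eq_div_iff (mul_ne_zero h2 h1) h4]
  field_simp
  ring

/-- Here 1 - f/w stays in the disc of radius 1 about 1, so its logarithm is a primitive on the
circle. -/
theorem circleIntegral_logDeriv_sub_const_of_gt {f : ℂ → ℂ} {s : ℝ} (hs : 0 < s) {w : ℂ}
    (hf : AnalyticOnNhd ℂ f (sphere 0 s)) (hw : ∀ z ∈ sphere (0 : ℂ) s, ‖f z‖ < ‖w‖) :
    (∮ z in C(0, s), logDeriv (fun z ↦ f z - w) z) = 0 := by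
  refine circleIntegral.integral_eq_zero_of_hasDerivWithinAt (f := fun z ↦ Complex.log (1 - f z / w))
    hs.le fun z hz ↦ HasDerivAt.hasDerivWithinAt ?_
  have hd := (hf z hz).differentiableAt.hasDerivAt
  have hw0 : 0 < ‖w‖ := (norm_nonneg _).trans_lt (hw z hz)
  have hw0' : w ≠ 0 := norm_pos_iff.1 hw0
  have hslit : 1 - f z / w ∈ slitPlane := by
    rw [sub_eq_add_neg]
    refine mem_slitPlane_of_norm_lt_one ?_
    rw [norm_neg, norm_div, div_lt_one hw0]
    exact hw z hz
  convert! ((hd.div_const w).const_sub 1).clog hslit using 1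
  rw [logDeriv_apply, deriv_sub_const]
  have h2 : f z - w ≠ 0 := fun h ↦ by
    have := hw z hz
    rw [sub_eq_zero.1 h] at this
    exact lt_irrefl _ this
  have h3 : f z - w = -(w * (1 - f z / w)) := by field_simp; ring
  have h4 : 1 - f z / w ≠ 0 := fun h ↦ h2 (by rw [h3, h, mul_zero, neg_zero])
  rw [h3]
  field_simp

/-- The region contains the closed annulus, so the slit map is analytic across both boundary
circles. -/
theorem differentiableAt_slitExponent {r ρ : ℝ} (hr0 : 0 < r) (hρ : ρ ∈ Ioo r 1) {z : ℂ}
    (hz1 : r ^ 2 / ρ < ‖z‖) (hz2 : ‖z‖ < ρ⁻¹) : DifferentiableAt ℂ (slitExponent r ρ) z := by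
  have hρ0 : 0 < ρ := hr0.trans hρ.1
  have hq0 : 0 < r ^ 2 := by positivity
  have hq1 : r ^ 2 < 1 := pow_lt_one₀ hr0.le (hρ.1.trans hρ.2) two_ne_zero
  have hqρ : r ^ 2 < ρ ^ 2 := pow_lt_pow_left₀ hρ.1 hr0.le two_ne_zero
  have hz0 : 0 < ‖z‖ := (by positivity : 0 < r ^ 2 / ρ).trans hz1
  have hz : z ≠ 0 := norm_pos_iff.1 hz0
  have hρc : (ρ : ℂ) ≠ 0 := by exact_mod_cast hρ0.ne'
  have e1 := (div_lt_iff₀ hρ0).1 hz1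
  have e2 : ‖z‖ * ρ < 1 := by rwa [← lt_div_iff₀ hρ0, one_div]
  have n1 : ‖(ρ : ℂ) * z‖ < 1 := by
    rw [norm_mul, norm_real, Real.norm_of_nonneg hρ0.le]; linarith
  have n2 : ‖(r : ℂ) ^ 2 / (ρ * z)‖ < 1 := by
    rw [norm_div, norm_mul, norm_pow, norm_real, norm_real, Real.norm_of_nonneg hρ0.le,
      Real.norm_of_nonneg hr0.le, div_lt_one (by positivity)]
    linarith
  have n3 : ‖(r : ℂ) ^ 2 * (z / ρ)‖ < 1 := by
    rw [norm_mul, norm_div, norm_pow, norm_real, norm_real, Real.norm_of_nonneg hρ0.le,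
      Real.norm_of_nonneg hr0.le, ← mul_div_assoc, div_lt_one hρ0]
    have h1 : r ^ 2 * ‖z‖ * ρ ≤ r ^ 2 := by
      rw [mul_assoc]; exact mul_le_of_le_one_right hq0.le e2.le
    have h2 : r ^ 2 * ‖z‖ * ρ < ρ * ρ := by nlinarith
    exact lt_of_mul_lt_mul_right h2 hρ0.le
  have n4 : ‖(r : ℂ) ^ 2 * (ρ / z)‖ < 1 := by
    rw [norm_mul, norm_div, norm_pow, norm_real, norm_real, Real.norm_of_nonneg hρ0.le,
      Real.norm_of_nonneg hr0.le, ← mul_div_assoc, div_lt_one hz0]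
    have : r ^ 2 * ρ ≤ r ^ 2 * 1 := mul_le_mul_of_nonneg_left hρ.2.le hq0.le
    have : ‖z‖ * ρ ≤ ‖z‖ * 1 := mul_le_mul_of_nonneg_left hρ.2.le hz0.le
    linarith
  have d (x : ℂ) (hx : ‖x‖ < 1) := differentiableAt_qLog hq0 hq1 hx
  unfold slitExponent
  refine ((DifferentiableAt.add ?_ ?_).sub ?_).sub ?_
  · exact (d _ n1).comp z (f := fun z : ℂ ↦ (ρ : ℂ) * z) (by fun_prop)
  · exact (d _ n2).comp z (f := fun z : ℂ ↦ (r : ℂ) ^ 2 / (ρ * z))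
      ((differentiableAt_const _).div (by fun_prop) (mul_ne_zero hρc hz))
  · exact (d _ n3).comp z (f := fun z : ℂ ↦ (r : ℂ) ^ 2 * (z / ρ)) (by fun_prop)
  · exact (d _ n4).comp z (f := fun z : ℂ ↦ (r : ℂ) ^ 2 * (ρ / z))
      ((differentiableAt_const _).mul ((differentiableAt_const _).div differentiableAt_id hz))

theorem analyticAt_slitExponent {r ρ : ℝ} (hr0 : 0 < r) (hρ : ρ ∈ Ioo r 1) {z : ℂ}
    (hz1 : r ≤ ‖z‖) (hz2 : ‖z‖ ≤ 1) : AnalyticAt ℂ (slitExponent r ρ) z := by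
  have hρ0 : 0 < ρ := hr0.trans hρ.1
  have hopen : IsOpen {z : ℂ | r ^ 2 / ρ < ‖z‖ ∧ ‖z‖ < ρ⁻¹} :=
    (isOpen_lt continuous_const continuous_norm).inter (isOpen_lt continuous_norm continuous_const)
  have hd : DifferentiableOn ℂ (slitExponent r ρ) {z : ℂ | r ^ 2 / ρ < ‖z‖ ∧ ‖z‖ < ρ⁻¹} :=
    fun z hz ↦ (differentiableAt_slitExponent hr0 hρ hz.1 hz.2).differentiableWithinAt
  refine hd.analyticAt (hopen.mem_nhds ⟨lt_of_lt_of_le ?_ hz1, hz2.trans_lt ?_⟩)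
  · rw [div_lt_iff₀ hρ0, sq]; exact mul_lt_mul_of_pos_left hρ.1 hr0
  · exact (one_lt_inv₀ hρ0).2 hρ.2

theorem analyticAt_slitMap {r ρ : ℝ} (hr0 : 0 < r) (hρ : ρ ∈ Ioo r 1) {z : ℂ}
    (hz1 : r ≤ ‖z‖) (hz2 : ‖z‖ ≤ 1) : AnalyticAt ℂ (slitMap r ρ) z :=
  (analyticAt_id.sub analyticAt_const).mul (analyticAt_slitExponent hr0 hρ hz1 hz2).cexp

theorem norm_slitMap (r ρ : ℝ) (z : ℂ) :
    ‖slitMap r ρ z‖ = ‖z - ρ‖ * Real.exp (slitExponent r ρ z).re := by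
  rw [slitMap, norm_mul, Complex.norm_exp]

/-- Since 1/z is the conjugate of z, the second and third terms of the exponent are conjugate and
cancel in real part. The first and fourth leave -log ‖1 - ρz‖, and ‖1 - ρz‖ = ‖z - ρ‖ on the unit
circle. -/
theorem norm_slitMap_of_norm_eq_one {r ρ : ℝ} (hr0 : 0 < r) (hρ : ρ ∈ Ioo r 1) {z : ℂ}
    (hz : ‖z‖ = 1) : ‖slitMap r ρ z‖ = 1 := by
  have hρ0 : 0 < ρ := hr0.trans hρ.1
  have hq0 : 0 < r ^ 2 := by positivity
  have hq1 : r ^ 2 < 1 := pow_lt_one₀ hr0.le (hρ.1.trans hρ.2) two_ne_zero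
  have hzz : z * conj z = 1 := by rw [mul_conj, normSq_eq_norm_sq, hz]; simp
  have hz0 : z ≠ 0 := fun h ↦ by simp [h] at hz
  have hzc : z⁻¹ = conj z := by field_simp; exact hzz.symm
  have hρc : (ρ : ℂ) ≠ 0 := by exact_mod_cast hρ0.ne'
  have a1 : (r : ℂ) ^ 2 / (ρ * z) = conj ((r : ℂ) ^ 2 * (z / ρ)) := by
    simp only [map_mul, map_pow, map_div₀, conj_ofReal, ← hzc]; field_simp
  have a2 : (r : ℂ) ^ 2 * (ρ / z) = conj (((r ^ 2 : ℝ) : ℂ) * (ρ * z)) := by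
    simp only [map_mul, conj_ofReal, ← hzc]; push_cast; field_simp
  have hn : ‖(ρ : ℂ) * z‖ < 1 := by
    rw [norm_mul, norm_real, Real.norm_of_nonneg hρ0.le, hz, mul_one]; exact hρ.2
  have hre : (slitExponent r ρ z).re = -Real.log ‖1 - ρ * z‖ := by
    have := congrArg re (qLog_sub_qLog_mul hq0 hq1 hn)
    rw [sub_re, neg_re, log_re] at this
    rw [slitExponent, a1, a2, sub_re, sub_re, add_re, qLog_conj_re, qLog_conj_re, ← this]
    ring
  have hfac : 1 - ρ * z = z * conj (z - ρ) := by
    rw [map_sub, conj_ofReal, mul_sub, hzz]; ring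
  have hne : ‖1 - ρ * z‖ ≠ 0 := by
    rw [norm_ne_zero_iff]
    intro h
    rw [← sub_eq_zero.1 h, norm_one] at hn
    exact lt_irrefl _ hn
  have hnn : ‖1 - ρ * z‖ = ‖z - ρ‖ := by rw [hfac, norm_mul, hz, one_mul, norm_conj]
  rw [norm_slitMap, hre, Real.exp_neg, Real.exp_log (by positivity), ← hnn, mul_inv_cancel₀ hne]

/-- Now r²/z is the conjugate of z, so the first and fourth terms cancel in real part. The other two
leave -log ‖1 - z/ρ‖, against ‖z - ρ‖ = ρ‖1 - z/ρ‖. -/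
theorem norm_slitMap_of_norm_eq {r ρ : ℝ} (hr0 : 0 < r) (hρ : ρ ∈ Ioo r 1) {z : ℂ}
    (hz : ‖z‖ = r) : ‖slitMap r ρ z‖ = ρ := by
  have hρ0 : 0 < ρ := hr0.trans hρ.1
  have hq0 : 0 < r ^ 2 := by positivity
  have hq1 : r ^ 2 < 1 := pow_lt_one₀ hr0.le (hρ.1.trans hρ.2) two_ne_zero
  have hzz : z * conj z = (r : ℂ) ^ 2 := by rw [mul_conj, normSq_eq_norm_sq, hz]; simp
  have hz0 : z ≠ 0 := fun h ↦ by simp [h] at hz; exact hr0.ne hz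
  have hρc : (ρ : ℂ) ≠ 0 := by exact_mod_cast hρ0.ne'
  have a1 : (r : ℂ) ^ 2 / (ρ * z) = conj (z / ρ) := by
    rw [map_div₀, conj_ofReal, ← hzz]; field_simp
  have a2 : (r : ℂ) ^ 2 * (ρ / z) = conj (ρ * z) := by
    rw [map_mul, conj_ofReal, ← hzz]; field_simp
  have hn : ‖z / ρ‖ < 1 := by
    rw [norm_div, norm_real, Real.norm_of_nonneg hρ0.le, hz, div_lt_one hρ0]; exact hρ.1
  have hre : (slitExponent r ρ z).re = -Real.log ‖1 - z / ρ‖ := by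
    have := congrArg re (qLog_sub_qLog_mul hq0 hq1 hn)
    rw [sub_re, neg_re, log_re] at this
    push_cast at this
    rw [slitExponent, a1, a2, sub_re, sub_re, add_re, qLog_conj_re, qLog_conj_re, ← this]
    ring
  have hne : ‖1 - z / ρ‖ ≠ 0 := by
    rw [norm_ne_zero_iff]
    intro h
    rw [← sub_eq_zero.1 h, norm_one] at hn
    exact lt_irrefl _ hn
  have hnn : ‖z - ρ‖ = ρ * ‖1 - z / ρ‖ := by
    have : z - ρ = -(ρ * (1 - z / ρ)) := by field_simp; ring
    rw [this, norm_neg, norm_mul, norm_real, Real.norm_of_nonneg hρ0.le]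
  rw [norm_slitMap, hre, Real.exp_neg, Real.exp_log (by positivity), hnn, mul_assoc,
    mul_inv_cancel₀ hne, mul_one]

/-! ### Counting preimages and injectivity of the slit map -/

/-- The exponent is single-valued on the circle, so its derivative integrates to zero and only the
factor z - ρ contributes. -/
theorem circleIntegral_logDeriv_slitMap {r ρ : ℝ} (hr0 : 0 < r) (hρ : ρ ∈ Ioo r 1) {s : ℝ}
    (hs1 : r ≤ s) (hs2 : s ≤ 1) (hsρ : s ≠ ρ) :
    (∮ z in C(0, s), logDeriv (slitMap r ρ) z) = ∮ z in C(0, s), (z - (ρ : ℂ))⁻¹ := by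
  have hρ0 : 0 < ρ := hr0.trans hρ.1
  have hs : 0 < s := hr0.trans_le hs1
  have hH : ∀ z ∈ sphere (0 : ℂ) s, AnalyticAt ℂ (slitExponent r ρ) z := by
    intro z hz
    rw [mem_sphere_zero_iff_norm] at hz
    exact analyticAt_slitExponent hr0 hρ (by rw [hz]; exact hs1) (by rw [hz]; exact hs2)
  have hne : ∀ z ∈ sphere (0 : ℂ) s, z - (ρ : ℂ) ≠ 0 := by
    intro z hz h
    rw [mem_sphere_zero_iff_norm, sub_eq_zero.1 h, norm_real, Real.norm_of_nonneg hρ0.le] at hz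
    exact hsρ hz.symm
  have hlog : ∀ z ∈ sphere (0 : ℂ) s,
      logDeriv (slitMap r ρ) z = (z - (ρ : ℂ))⁻¹ + deriv (slitExponent r ρ) z := by
    intro z hz
    have hd := (hH z hz).differentiableAt.hasDerivAt
    have h := ((hasDerivAt_id z).sub_const (ρ : ℂ)).mul hd.cexp
    have h' : HasDerivAt (slitMap r ρ) (1 * cexp (slitExponent r ρ z) +
      (z - ρ) * (cexp (slitExponent r ρ z) * deriv (slitExponent r ρ) z)) z := h
    have := hne z hz
    have he := Complex.exp_ne_zero (slitExponent r ρ z)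
    rw [logDeriv_apply, h'.deriv, slitMap]
    field_simp
  rw [circleIntegral.integral_congr hs.le hlog, circleIntegral.integral_add,
    circleIntegral.integral_eq_zero_of_hasDerivWithinAt (f := slitExponent r ρ) hs.le
      fun z hz ↦ (hH z hz).differentiableAt.hasDerivAt.hasDerivWithinAt, add_zero]
  · exact ContinuousOn.circleIntegrable hs.le (ContinuousOn.inv₀ (by fun_prop) hne)
  · exact ContinuousOn.circleIntegrable hs.le fun z hz ↦
      (hH z hz).deriv.continuousAt.continuousWithinAt

theorem exists_mem_norm_gt_of_mem_nhds {w : ℂ} (hw : w ≠ 0) {V : Set ℂ} (hV : V ∈ 𝓝 w) :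
    ∃ w' ∈ V, ‖w‖ < ‖w'‖ := by
  have ht : Tendsto (fun t : ℝ ↦ ((1 + t : ℝ) : ℂ) * w) (𝓝[>] 0) (𝓝 w) := by
    have : ContinuousAt (fun t : ℝ ↦ ((1 + t : ℝ) : ℂ) * w) 0 := by fun_prop
    have h := this.tendsto
    simp only [add_zero, ofReal_one, one_mul] at h
    exact h.mono_left nhdsWithin_le_nhds
  obtain ⟨t, h1, h2⟩ := ((ht.eventually hV).and eventually_mem_nhdsWithin).exists
  refine ⟨_, h1, ?_⟩
  have h3 : (0 : ℝ) < t := h2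
  rw [norm_mul, norm_real, Real.norm_of_nonneg (by linarith)]
  have := norm_pos_iff.2 hw
  nlinarith

theorem slitMap_zeroCount {r ρ : ℝ} (hr0 : 0 < r) (hρ : ρ ∈ Ioo r 1) {w : ℂ} (hw1 : ‖w‖ ≠ 1)
    (hwρ : ‖w‖ ≠ ρ) : ∃ (Z : Finset ℂ) (n : ℂ → ℤ),
      (∀ u, u ∈ Z ↔ u ∈ annulus r ∧ slitMap r ρ u = w) ∧ (∀ u ∈ Z, 1 ≤ n u) ∧
        ∑ u ∈ Z, n u = if ‖w‖ < 1 then 1 else 0 := by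
  have hρ0 : 0 < ρ := hr0.trans hρ.1
  have hr1 : r < 1 := hρ.1.trans hρ.2
  have hf : AnalyticOnNhd ℂ (slitMap r ρ) (closedBall 0 1 \ ball 0 r) := by
    rintro z ⟨h1, h2⟩
    rw [mem_closedBall_zero_iff] at h1
    rw [mem_ball_zero_iff, not_lt] at h2
    exact analyticAt_slitMap hr0 hρ h2 h1
  have n1 : ∀ z ∈ sphere (0 : ℂ) 1, ‖slitMap r ρ z‖ = 1 := fun z hz ↦
    norm_slitMap_of_norm_eq_one hr0 hρ (mem_sphere_zero_iff_norm.1 hz)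
  have nr : ∀ z ∈ sphere (0 : ℂ) r, ‖slitMap r ρ z‖ = ρ := fun z hz ↦
    norm_slitMap_of_norm_eq hr0 hρ (mem_sphere_zero_iff_norm.1 hz)
  have a1 : AnalyticOnNhd ℂ (slitMap r ρ) (sphere 0 1) := fun z hz ↦ by
    rw [mem_sphere_zero_iff_norm] at hz
    exact analyticAt_slitMap hr0 hρ (hz ▸ hr1.le) hz.le
  have ar : AnalyticOnNhd ℂ (slitMap r ρ) (sphere 0 r) := fun z hz ↦ by
    rw [mem_sphere_zero_iff_norm] at hz
    exact analyticAt_slitMap hr0 hρ hz.ge (hz.trans_le hr1.le)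
  have hI1 : (∮ z in C(0, 1), logDeriv (slitMap r ρ) z) = 2 * π * I := by
    rw [circleIntegral_logDeriv_slitMap hr0 hρ hr1.le le_rfl hρ.2.ne',
      circleIntegral.integral_sub_inv_of_mem_ball]
    rw [mem_ball_zero_iff, norm_real, Real.norm_of_nonneg hρ0.le]
    exact hρ.2
  have hIr : (∮ z in C(0, r), logDeriv (slitMap r ρ) z) = 0 := by
    rw [circleIntegral_logDeriv_slitMap hr0 hρ le_rfl hr1.le hρ.1.ne,
      circleIntegral_inv_sub_eq_zero hr0.le]
    rw [norm_real, Real.norm_of_nonneg hρ0.le]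
    exact hρ.1
  -- The inner circle contributes nothing on either side of ‖w‖ = ρ: for smaller ‖w‖ the integral is
  -- that of w = 0, for larger ‖w‖ there is no winding.
  have hJr : (∮ z in C(0, r), logDeriv (fun z ↦ slitMap r ρ z - w) z) = 0 := by
    rcases lt_or_gt_of_ne hwρ with h | h
    · rw [circleIntegral_logDeriv_sub_const_of_lt hr0 ar (fun z hz ↦ by rwa [nr z hz]), hIr]
    · exact circleIntegral_logDeriv_sub_const_of_gt hr0 ar (fun z hz ↦ by rwa [nr z hz])
  have hJ1 : (∮ z in C(0, 1), logDeriv (fun z ↦ slitMap r ρ z - w) z) =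
      2 * π * I * (if ‖w‖ < 1 then 1 else 0) := by
    split_ifs with h
    · rw [circleIntegral_logDeriv_sub_const_of_lt one_pos a1 (fun z hz ↦ by rwa [n1 z hz]), hI1,
        mul_one]
    · rw [circleIntegral_logDeriv_sub_const_of_gt one_pos a1 (fun z hz ↦ by
        rw [n1 z hz]; exact lt_of_le_of_ne (not_lt.1 h) hw1.symm), mul_zero]
  obtain ⟨Z, n, hZ, hn, hsum⟩ := exists_circleIntegral_logDeriv_sub_eq hr0 hr1
    (F := fun z ↦ slitMap r ρ z - w) (fun z hz ↦ (hf z hz).sub analyticAt_const)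
    (fun z hz h ↦ hwρ (by rw [← sub_eq_zero.1 h, nr z hz]))
    (fun z hz h ↦ hw1 (by rw [← sub_eq_zero.1 h, n1 z hz]))
  refine ⟨Z, n, fun u ↦ (hZ u).trans (by rw [sub_eq_zero]; rfl), hn, ?_⟩
  rw [hJ1, hJr, sub_zero] at hsum
  have := mul_left_cancel₀ two_pi_I_ne_zero hsum
  split_ifs at this ⊢ <;> exact_mod_cast this.symm

theorem slitMap_self (r ρ : ℝ) : slitMap r ρ ρ = 0 := by simp [slitMap]

theorem isOpen_image_slitMap {r ρ : ℝ} (hr0 : 0 < r) (hρ : ρ ∈ Ioo r 1) :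
    ∀ s ⊆ annulus r, IsOpen s → IsOpen (slitMap r ρ '' s) := by
  have hf : AnalyticOnNhd ℂ (slitMap r ρ) (annulus r) := fun z hz ↦
    analyticAt_slitMap hr0 hρ hz.1.le hz.2.le
  refine (hf.is_constant_or_isOpen (isPreconnected_annulus hr0)).resolve_left ?_
  rintro ⟨w, hw⟩
  have hρ0 : 0 < ρ := hr0.trans hρ.1
  have h1 : (ρ : ℂ) ∈ annulus r := by
    simp only [annulus, mem_ofPred_eq, norm_real, Real.norm_of_nonneg hρ0.le]
    exact hρ
  have h2 : ((-ρ : ℝ) : ℂ) ∈ annulus r := by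
    simp only [annulus, mem_ofPred_eq, norm_real, norm_neg, Real.norm_of_nonneg hρ0.le]
    exact hρ
  have h3 := (hw _ h2).trans (hw _ h1).symm
  rw [slitMap_self, slitMap, mul_eq_zero, or_iff_left (Complex.exp_ne_zero _), sub_eq_zero,
    ofReal_inj] at h3
  linarith

theorem isHolomorphicEmbeddingIntoBall_slitMap {r ρ : ℝ} (hr0 : 0 < r) (hρ : ρ ∈ Ioo r 1) :
    IsHolomorphicEmbeddingIntoBall (annulus r) (ρ : ℂ) (slitMap r ρ) := by
  have hρ0 : 0 < ρ := hr0.trans hρ.1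
  have hle : ∀ z ∈ annulus r, ‖slitMap r ρ z‖ ≤ 1 := by
    intro z hz
    by_contra! h
    obtain ⟨Z, n, hZ, hn, hsum⟩ := slitMap_zeroCount hr0 hρ h.ne' (hρ.2.trans h).ne'
    rw [if_neg h.le.not_gt] at hsum
    have hzZ := (hZ z).2 ⟨hz, rfl⟩
    have := Finset.single_le_sum (fun u hu ↦ zero_le_one.trans (hn u hu)) hzZ
    have := hn z hzZ
    omega
  have hlt : ∀ z ∈ annulus r, ‖slitMap r ρ z‖ < 1 := by
    intro z hz
    -- By openness, a value of modulus 1 would force values of modulus greater than 1.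
    refine lt_of_le_of_ne (hle z hz) fun h ↦ ?_
    obtain ⟨_, ⟨u, hu, rfl⟩, h2⟩ := exists_mem_norm_gt_of_mem_nhds
      (norm_ne_zero_iff.1 (by rw [h]; exact one_ne_zero))
      ((isOpen_image_slitMap hr0 hρ _ subset_rfl (isOpen_annulus r)).mem_nhds ⟨z, hz, rfl⟩)
    exact absurd (hle u hu) (by rw [h] at h2; exact not_le.2 h2)
  refine ⟨fun z hz ↦ (analyticAt_slitMap hr0 hρ hz.1.le
    hz.2.le).differentiableAt.differentiableWithinAt, ?_,
    fun z hz ↦ mem_ball_zero_iff.2 (hlt z hz), slitMap_self r ρ⟩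
  have hdis : ∀ a ∈ annulus r, ∀ b ∈ annulus r, slitMap r ρ a = slitMap r ρ b →
      ‖slitMap r ρ a‖ ≠ ρ → a = b := by
    intro a ha b hb hab hne
    by_contra hne'
    obtain ⟨Z, n, hZ, hn, hsum⟩ := slitMap_zeroCount hr0 hρ (hlt a ha).ne hne
    rw [if_pos (hlt a ha)] at hsum
    have haZ := (hZ a).2 ⟨ha, rfl⟩
    have hbZ := (hZ b).2 ⟨hb, hab.symm⟩
    have hsub : ({a, b} : Finset ℂ) ⊆ Z := by
      intro u hu
      rcases Finset.mem_insert.1 hu with rfl | hu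
      · exact haZ
      · rw [Finset.mem_singleton.1 hu]; exact hbZ
    have h1 := Finset.sum_le_sum_of_subset_of_nonneg hsub
      fun u hu _ ↦ zero_le_one.trans (hn u hu)
    rw [Finset.sum_pair hne'] at h1
    have := hn a haZ
    have := hn b hbZ
    omega
  intro a ha b hb hab
  by_contra hne
  -- The count omits modulus ρ. A double value there persists, by openness of the images of disjoint
  -- neighbourhoods, to a double value of slightly larger modulus.
  by_cases hw : ‖slitMap r ρ a‖ = ρ
  · obtain ⟨Va, Vb, hVa, hVb, haV, hbV, hdisj⟩ := t2_separation hne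
    have hA := isOpen_image_slitMap hr0 hρ _ inter_subset_left ((isOpen_annulus r).inter hVa)
    have hB := isOpen_image_slitMap hr0 hρ _ inter_subset_left ((isOpen_annulus r).inter hVb)
    obtain ⟨w, ⟨⟨u, hu, huw⟩, ⟨v, hv, hvw⟩⟩, hw'⟩ := exists_mem_norm_gt_of_mem_nhds
      (norm_ne_zero_iff.1 (by rw [hw]; exact hρ0.ne'))
      (inter_mem (hA.mem_nhds ⟨a, ⟨ha, haV⟩, rfl⟩) (hB.mem_nhds ⟨b, ⟨hb, hbV⟩, hab.symm⟩))
    have huv := hdis u hu.1 v hv.1 (huw.trans hvw.symm) (by rw [huw, ← hw]; exact hw'.ne')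
    exact disjoint_left.1 hdisj hu.2 (huv ▸ hv.2)
  · exact hne (hdis a ha b hb hab hw)

/-! ### Value of the squeezing function and its symmetries -/

theorem bddAbove_ball_subset_image {D : Set ℂ} {p : ℂ} {f : ℂ → ℂ}
    (hf : IsHolomorphicEmbeddingIntoBall D p f) : BddAbove {t : ℝ | ball (0 : ℂ) t ⊆ f '' D} := by
  refine ⟨1, fun t ht ↦ ?_⟩
  by_contra! h
  have h1 : (1 : ℂ) ∈ ball (0 : ℂ) t := by simpa using h
  obtain ⟨z, hz, hz1⟩ := ht h1
  have := hf.mapsTo hz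
  rw [hz1] at this
  simp at this

theorem le_squeezingRadius_slitMap {r ρ : ℝ} (hr0 : 0 < r) (hρ : ρ ∈ Ioo r 1) :
    ρ ≤ squeezingRadius (annulus r) (slitMap r ρ) := by
  refine le_csSup (bddAbove_ball_subset_image (isHolomorphicEmbeddingIntoBall_slitMap hr0 hρ)) ?_
  intro w hw
  rw [mem_ball_zero_iff] at hw
  obtain ⟨Z, n, hZ, -, hsum⟩ := slitMap_zeroCount hr0 hρ (hw.trans hρ.2).ne hw.ne
  rw [if_pos (hw.trans hρ.2)] at hsum
  have hne : Z.Nonempty := by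
    by_contra h
    rw [Finset.not_nonempty_iff_eq_empty] at h
    simp [h] at hsum
  obtain ⟨u, hu⟩ := hne
  exact ⟨u, (hZ u).1 hu⟩

theorem squeezingFunction_annulus_of_le {r ρ : ℝ} (hr0 : 0 < r) (hρ : ρ ∈ Ioo r 1)
    (hr : √r ≤ ρ) : squeezingFunction (annulus r) (ρ : ℂ) = ρ := by
  have hρ0 : 0 < ρ := hr0.trans hρ.1
  have hmax : max ρ (r / ρ) = ρ := by
    refine max_eq_left ((div_le_iff₀ hρ0).2 ?_)
    rw [← sq]
    exact (Real.sqrt_le_left hρ0.le).1 hr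
  have hub : ∀ s ∈ {s : ℝ | ∃ f : ℂ → ℂ, IsHolomorphicEmbeddingIntoBall (annulus r) (ρ : ℂ) f ∧
      s = squeezingRadius (annulus r) f}, s ≤ ρ := by
    rintro s ⟨f, hf, rfl⟩
    exact (squeezingRadius_annulus_le hr0 hρ hf).trans_eq hmax
  have hmem : squeezingRadius (annulus r) (slitMap r ρ) ∈
      {s : ℝ | ∃ f : ℂ → ℂ, IsHolomorphicEmbeddingIntoBall (annulus r) (ρ : ℂ) f ∧
      s = squeezingRadius (annulus r) f} :=
    ⟨_, isHolomorphicEmbeddingIntoBall_slitMap hr0 hρ, rfl⟩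
  refine le_antisymm (csSup_le ⟨_, hmem⟩ hub) ?_
  exact (le_squeezingRadius_slitMap hr0 hρ).trans (le_csSup ⟨ρ, hub⟩ hmem)

/-- The squeezing function is invariant under automorphisms of the domain. -/
theorem squeezingFunction_comp_automorphism {D : Set ℂ} {φ ψ : ℂ → ℂ}
    (hφ : DifferentiableOn ℂ φ D) (hψ : DifferentiableOn ℂ ψ D) (hφD : MapsTo φ D D)
    (hψD : MapsTo ψ D D) (hφψ : LeftInvOn ψ φ D) (hψφ : LeftInvOn φ ψ D) {p : ℂ} (hp : p ∈ D) :
    squeezingFunction D (φ p) = squeezingFunction D p := by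
  have himg : ∀ {φ ψ : ℂ → ℂ}, MapsTo φ D D → MapsTo ψ D D → LeftInvOn φ ψ D → φ '' D = D := by
    intro φ ψ h1 h2 h3
    refine subset_antisymm h1.image_subset fun z hz ↦ ⟨ψ z, h2 hz, h3 hz⟩
  have key : ∀ {φ ψ : ℂ → ℂ}, DifferentiableOn ℂ φ D → MapsTo φ D D → MapsTo ψ D D →
      LeftInvOn ψ φ D → LeftInvOn φ ψ D → ∀ {p q : ℂ}, φ p = q →
      ∀ {f : ℂ → ℂ}, IsHolomorphicEmbeddingIntoBall D q f →
        IsHolomorphicEmbeddingIntoBall D p (f ∘ φ) ∧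
        squeezingRadius D f = squeezingRadius D (f ∘ φ) := by
    intro φ ψ hφ h1 h2 h3 h4 p q hpq f hf
    refine ⟨⟨hf.differentiableOn.comp hφ h1, hf.injOn.comp h3.injOn h1, hf.mapsTo.comp h1, ?_⟩, ?_⟩
    · rw [Function.comp_apply, hpq, hf.map_base]
    · rw [squeezingRadius, squeezingRadius, image_comp, himg h1 h2 h4]
  unfold squeezingFunction
  congr 1
  ext s
  constructor
  · rintro ⟨f, hf, rfl⟩
    exact ⟨_, key hφ hφD hψD hφψ hψφ rfl hf⟩
  · rintro ⟨f, hf, rfl⟩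
    exact ⟨_, key hψ hψD hφD hψφ hφψ (hφψ hp) hf⟩

theorem squeezingFunction_annulus_norm {r : ℝ} (hr0 : 0 < r) {z : ℂ} (hz : z ∈ annulus r) :
    squeezingFunction (annulus r) z = squeezingFunction (annulus r) ((‖z‖ : ℝ) : ℂ) := by
  have hz0 : 0 < ‖z‖ := hr0.trans hz.1
  have hzc : z ≠ 0 := norm_pos_iff.1 hz0
  have hnc : ((‖z‖ : ℝ) : ℂ) ≠ 0 := by exact_mod_cast hz0.ne'
  have hmap : ∀ c : ℂ, ‖c‖ = 1 → MapsTo (fun w ↦ c * w) (annulus r) (annulus r) := by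
    intro c hc w hw
    simpa only [annulus, mem_ofPred_eq, norm_mul, hc, one_mul] using hw
  have hc1 : ‖z / (‖z‖ : ℝ)‖ = 1 := by
    rw [norm_div, norm_real, norm_norm, div_self hz0.ne']
  have hc2 : ‖((‖z‖ : ℝ) : ℂ) / z‖ = 1 := by
    rw [norm_div, norm_real, norm_norm, div_self hz0.ne']
  have h := squeezingFunction_comp_automorphism (D := annulus r)
    (φ := fun w ↦ z / (‖z‖ : ℝ) * w) (ψ := fun w ↦ ((‖z‖ : ℝ) : ℂ) / z * w) (by fun_prop)
    (by fun_prop) (hmap _ hc1) (hmap _ hc2) (fun w _ ↦ by field_simp) (fun w _ ↦ by field_simp)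
    (p := ((‖z‖ : ℝ) : ℂ)) (by simpa [annulus] using hz)
  rwa [div_mul_cancel₀ _ hnc] at h

theorem squeezingFunction_annulus_div {r : ℝ} (hr0 : 0 < r) {z : ℂ} (hz : z ∈ annulus r) :
    squeezingFunction (annulus r) (r / z) = squeezingFunction (annulus r) z := by
  have h0 : ∀ w ∈ annulus r, w ≠ 0 := fun w hw ↦ norm_pos_iff.1 (hr0.trans hw.1)
  have hrc : (r : ℂ) ≠ 0 := by exact_mod_cast hr0.ne'
  have hmap : MapsTo (fun w : ℂ ↦ (r : ℂ) / w) (annulus r) (annulus r) := by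
    intro w hw
    have hw0 : 0 < ‖w‖ := hr0.trans hw.1
    simp only [annulus, mem_ofPred_eq, norm_div, norm_real, Real.norm_of_nonneg hr0.le]
    refine ⟨(lt_div_iff₀ hw0).2 ?_, (div_lt_one hw0).2 hw.1⟩
    exact mul_lt_of_lt_one_right hr0 hw.2
  have hd : DifferentiableOn ℂ (fun w : ℂ ↦ (r : ℂ) / w) (annulus r) :=
    (differentiableOn_const _).div differentiableOn_id h0
  have hinv : LeftInvOn (fun w : ℂ ↦ (r : ℂ) / w) (fun w : ℂ ↦ (r : ℂ) / w) (annulus r) := by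
    intro w hw
    have := h0 w hw
    field_simp
  exact squeezingFunction_comp_automorphism hd hd hmap hmap hinv hinv hz

theorem mainTheorem9 (r : ℝ) (hr0 : 0 < r) (hr1 : r < 1) :
    (∀ z ∈ annulus r, squeezingFunction (annulus r) z
        = squeezingFunction (annulus r) ((‖z‖ : ℝ) : ℂ)) ∧
    (∀ ρ ∈ Set.Ioo r 1, squeezingFunction (annulus r) ((r / ρ : ℝ) : ℂ)
        = squeezingFunction (annulus r) (ρ : ℂ)) ∧
    StrictMonoOn (fun ρ : ℝ => squeezingFunction (annulus r) (ρ : ℂ)) (Set.Ico (√r) 1) ∧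
    (∀ z : ℂ, ‖z‖ = √r →
      z ∈ annulus r ∧ IsMinOn (squeezingFunction (annulus r)) (annulus r) z) := by
  have hsr : r < √r := by
    rw [Real.lt_sqrt hr0.le]
    nlinarith
  have hs1 : √r < 1 := by
    rw [Real.sqrt_lt' one_pos]
    simpa using hr1
  have hmem : ∀ ρ ∈ Ioo r 1, (ρ : ℂ) ∈ annulus r := by
    intro ρ hρ
    simp only [annulus, mem_ofPred_eq, norm_real, Real.norm_of_nonneg (hr0.trans hρ.1).le]
    exact hρ
  have hval : ∀ ρ ∈ Ico (√r) 1, squeezingFunction (annulus r) (ρ : ℂ) = ρ := fun ρ hρ ↦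
    squeezingFunction_annulus_of_le hr0 ⟨hsr.trans_le hρ.1, hρ.2⟩ hρ.1
  have hinv : ∀ ρ ∈ Ioo r 1, squeezingFunction (annulus r) ((r / ρ : ℝ) : ℂ)
      = squeezingFunction (annulus r) (ρ : ℂ) := by
    intro ρ hρ
    rw [ofReal_div]
    exact squeezingFunction_annulus_div hr0 (hmem ρ hρ)
  refine ⟨fun z hz ↦ squeezingFunction_annulus_norm hr0 hz, hinv, ?_, ?_⟩
  · intro a ha b hb hab
    simp only [hval a ha, hval b hb]
    exact hab
  · intro z hz
    have hzA : z ∈ annulus r := by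
      simp only [annulus, mem_ofPred_eq, hz]
      exact ⟨hsr, hs1⟩
    refine ⟨hzA, fun u hu ↦ ?_⟩
    rw [mem_ofPred_eq, squeezingFunction_annulus_norm hr0 hzA, squeezingFunction_annulus_norm hr0 hu,
      hz, hval _ ⟨le_rfl, hs1⟩]
    rcases le_total (√r) ‖u‖ with h | h
    · rwa [hval _ ⟨h, hu.2⟩]
    · have hu0 : 0 < ‖u‖ := hr0.trans hu.1
      -- Points inside the middle circle are reflected by ρ ↦ r/ρ into the range where the value is
      -- known.
      have h' : √r ≤ r / ‖u‖ := by
        rw [le_div_iff₀ hu0]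
        calc √r * ‖u‖ ≤ √r * √r := by gcongr
          _ = r := Real.mul_self_sqrt hr0.le
      rw [← hinv _ hu, hval _ ⟨h', (div_lt_one hu0).2 hu.1⟩]
      exact h'
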